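/- Let $S$ be an inverse semigroup: a semigroup in which every $s$ has a unique $s^*$ with $ss^*s=s$ and $s^*ss^*=s^*$. Let $E$ be its set of idempotents, and write $s\mathrel{\mathcal L}t$ if $us=t$ and $vt=s$ for some $u,v\in S$. Suppose that $S$ is quasi-countable, i.e. generated as an inverse semigroup by $X\cup E$ for some countable $X\subseteq S$. Let $d\colon S\times S\to[0,\infty]$ be an extended metric that - is uniformly discrete (there is $c>0$ with $d(x,y)>c$ whenever $x\ne y$) and has the $\mathcal L$-classes as its components (i.e. $d(x,y)<\infty$ if and only if $x\mathrel{\mathcal L}y$); - is right subinvariant: $d(sx,tx)\le d(s,t)$ for all $s,t,x\in S$; - is proper: for every $r\ge 0$ there is a finite $F\subseteq S$ such that $y\in Fx$ whenever $x\neq y$ and $d(x,y)\le r$. Let $C_u^*(S,d)\subseteq\mathcal B(\ell^2(S))$ be the uniform Roe algebra, i.e. the C*-algebra generated by the operators $t$ of finite propagation (for some $r<\infty$, $\langle t\delta_x,\delta_y\rangle=0$ whenever $d(x,y)>r$). Then the following are equivalent: 1. $S$ is locally $\mathcal L$-finite: in each finitely generated inverse subsemigroup $T$ of $S$, all the $\mathcal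 L$-classes of $T$ are finite. 2. $(S,d)$ is sparse: every component of $(S,d)$ is the disjoint union of a finite or infinite sequence of nonempty finite sets $X_0,X_1,\dots$ such that $d(X_n,X_m)\to\infty$ as $n+m\to\infty$ with $n\ne m$. 3. $C_u^*(S,d)$ is quasi-diagonal: it has a faithful representation on a Hilbert space $H$ with image $B$ such that, for all finite $K\subseteq B$, finite $V\subseteq H$ and $\varepsilon>0$, there is a finite rank orthogonal projection $p$ on $H$ with $\|pa-ap\|\le\varepsilon$ for all $a\in K$ and $\|pv-v\|\le\varepsilon$ for all $v\in V$. 4. $C_u^*(S,d)$ is stably finite: $M_n(C_u^*(S,d))$ is finite for every $n$. 5. $C_u^*(S,d)$ is finite: it contains no $v$ with $v^*v=1$ and $vv^*\neq1$. Say that $(S,d)$ has asymptotic dimension $0$ if for every $r>0$ there is a cover of $S$ by sets of uniformly bounded (finite) diameter, any two distinct members of which are at distance greater than $r$. If $(S,d)$ has asymptotic dimension $0$, then the conditions 1–5 hold. The converse holds if $S$ is a group, but not in general: there are a quasi-countable inverse semigroup and a metric $d$ on it with the properties above for which $(S,d)$ is sparse but not of asymptotic dimension $0$. -/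

import Mathlib

open scoped ENNReal NNReal

universe u

namespace InvSemigroupRoe

/-! ### Inverse semigroups -/

/-- An inverse semigroup: every `s` has exactly one inverse `s⁻¹`, in the sense that
`s * s⁻¹ * s = s` and `s⁻¹ * s * s⁻¹ = s⁻¹`. -/
class InverseSemigroup (S : Type u) extends Semigroup S, Inv S where
  mul_inv_mul_self : ∀ s : S, s * s⁻¹ * s = s
  inv_mul_self_mul_inv : ∀ s : S, s⁻¹ * s * s⁻¹ = s⁻¹
  eq_inv_of_inverse : ∀ s t : S, s * t * s = s → t * s * t = t → t = s⁻¹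

/-- Every group is an inverse semigroup, with the same product and inverse. -/
instance groupInverseSemigroup (G : Type u) [Group G] : InverseSemigroup G where
  mul_inv_mul_self s := by group
  inv_mul_self_mul_inv s := by group
  eq_inv_of_inverse s t h _ := by
    have h' : s * t = 1 := by simpa using congrArg (· * s⁻¹) h
    exact (inv_eq_of_mul_eq_one_right h').symm

/-- Green's relation `𝓛`: `s` and `t` are left multiples of each other. -/
def LRel {S : Type u} [InverseSemigroup S] (s t : S) : Prop :=
  (∃ a : S, a * s = t) ∧ (∃ b : S, b * t = s)

/-- A subset closed under products and inverses. -/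
structure InverseSubsemigroup (S : Type u) [InverseSemigroup S] where
  carrier : Set S
  mul_mem' : ∀ {a b : S}, a ∈ carrier → b ∈ carrier → a * b ∈ carrier
  inv_mem' : ∀ {a : S}, a ∈ carrier → a⁻¹ ∈ carrier

namespace InverseSubsemigroup

variable {S : Type u} [InverseSemigroup S]

instance : SetLike (InverseSubsemigroup S) S where
  coe T := T.carrier
  coe_injective T T' h := by
    cases T; cases T'; congr

instance (T : InverseSubsemigroup S) : InverseSemigroup T where
  mul a b := ⟨(a : S) * (b : S), T.mul_mem' a.2 b.2⟩
  inv a := ⟨(a : S)⁻¹, T.inv_mem' a.2⟩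
  mul_assoc a b c := Subtype.ext (mul_assoc (a : S) b c)
  mul_inv_mul_self s := Subtype.ext (InverseSemigroup.mul_inv_mul_self (s : S))
  inv_mul_self_mul_inv s := Subtype.ext (InverseSemigroup.inv_mul_self_mul_inv (s : S))
  eq_inv_of_inverse s t h h' := Subtype.ext
    (InverseSemigroup.eq_inv_of_inverse (s : S) t
      (congrArg Subtype.val h) (congrArg Subtype.val h'))

/-- The inverse subsemigroup `⟨X⟩` generated by `X`: the intersection of all inverse
subsemigroups that contain `X`. -/
def closure (X : Set S) : InverseSubsemigroup S where
  carrier := {s | ∀ T : InverseSubsemigroup S, X ⊆ (T : Set S) → s ∈ T}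
  mul_mem' ha hb T hT := T.mul_mem' (ha T hT) (hb T hT)
  inv_mem' ha T hT := T.inv_mem' (ha T hT)

/-- `T` is finitely generated as an inverse semigroup. -/
def FG (T : InverseSubsemigroup S) : Prop :=
  ∃ F : Set S, F.Finite ∧ T = closure F

end InverseSubsemigroup

/-- `S = ⟨X ∪ E⟩` for some countable set `X`, where `E` is the set of idempotents. -/
def IsQuasiCountable (S : Type u) [InverseSemigroup S] : Prop :=
  ∃ X : Set S, X.Countable ∧
    ∀ s : S, s ∈ InverseSubsemigroup.closure (X ∪ {e : S | IsIdempotentElem e})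

/-- All `𝓛`-classes are finite. -/
def IsLFinite (S : Type u) [InverseSemigroup S] : Prop :=
  ∀ s : S, {t : S | LRel s t}.Finite

/-- Every finitely generated inverse subsemigroup is `𝓛`-finite (with respect to its own
relation `𝓛`). -/
def IsLocallyLFinite (S : Type u) [InverseSemigroup S] : Prop :=
  ∀ T : InverseSubsemigroup S, T.FG → IsLFinite T

/-! ### Extended metrics -/

/-- The distance between two sets; it is `∞` if one of them is empty. -/
noncomputable def setEDist {X : Type u} [EMetricSpace X] (A B : Set X) : ℝ≥0∞ :=
  ⨅ x ∈ A, ⨅ y ∈ B, edist x y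

/-- The component of `p`: all points at finite distance from `p`. -/
def component {X : Type u} [EMetricSpace X] (p : X) : Set X :=
  {x | edist p x < ∞}

/-- Sparseness: every component `C` is the disjoint union of finite sets `A 0, A 1, …` such that
the distance of `A n` and `A m`, for `n ≠ m`, tends to infinity as `n + m → ∞`. Some of the `A n`
may be empty, so that finite unions are covered; in particular finite components are allowed. -/
def IsSparse (X : Type u) [EMetricSpace X] : Prop :=
  ∀ p : X, ∃ A : ℕ → Set X,
    (∀ n, (A n).Finite) ∧
    (∀ n m, n ≠ m → Disjoint (A n) (A m)) ∧
    (⋃ n, A n) = component p ∧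
    ∀ R : ℝ≥0, ∃ N : ℕ, ∀ n m, n ≠ m → N ≤ n + m → (R : ℝ≥0∞) < setEDist (A n) (A m)

/-- Asymptotic dimension `0`: for every `r > 0` there is a cover by sets of uniformly bounded
diameter that are pairwise more than `r` apart. -/
def HasAsdimZero (X : Type u) [EMetricSpace X] : Prop :=
  ∀ r : ℝ≥0, 0 < r → ∃ U : Set (Set X),
    ⋃₀ U = Set.univ ∧
    (∃ D : ℝ≥0, ∀ A ∈ U, ∀ x ∈ A, ∀ y ∈ A, edist x y ≤ D) ∧
    ∀ A ∈ U, ∀ B ∈ U, A ≠ B → (r : ℝ≥0∞) < setEDist A B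

/-- The given extended metric on the inverse semigroup `S` is uniformly discrete, its components
are exactly the `𝓛`-classes, and it is right subinvariant and proper. -/
structure IsProperRightSubinvariant (S : Type u) [InverseSemigroup S] [EMetricSpace S] :
    Prop where
  uniformlyDiscrete : ∃ c : ℝ≥0, 0 < c ∧ ∀ x y : S, x ≠ y → (c : ℝ≥0∞) < edist x y
  component_eq : ∀ x y : S, edist x y < ∞ ↔ LRel x y
  rightSubinvariant : ∀ s t x : S, edist (s * x) (t * x) ≤ edist s t
  proper : ∀ r : ℝ≥0, ∃ F : Set S, F.Finite ∧
    ∀ x y : S, x ≠ y → edist x y ≤ r → ∃ f ∈ F, y = f * x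

/-! ### The uniform Roe algebra -/

/-- The Hilbert space `ℓ²(X)`. -/
abbrev EllTwo (X : Type u) : Type u := lp (fun _ : X => ℂ) 2

open Classical in
/-- The basis vector `δ_x` of `ℓ²(X)`. -/
noncomputable def delta {X : Type u} (x : X) : EllTwo X := lp.single 2 x (1 : ℂ)

/-- `t` has finite propagation: for some finite `r ≥ 0`, the matrix coefficient
`⟨t δ_x, δ_y⟩` vanishes whenever `d(x, y) > r`. -/
def HasFinitePropagation {X : Type u} [EMetricSpace X] (t : EllTwo X →L[ℂ] EllTwo X) : Prop :=
  ∃ r : ℝ≥0, ∀ x y : X, (r : ℝ≥0∞) < edist x y → inner ℂ (t (delta x)) (delta y) = 0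

/-- The uniform Roe algebra: the norm-closed `*`-subalgebra of `B(ℓ²(X))` generated by the
operators of finite propagation. -/
noncomputable def uniformRoeAlgebra (X : Type u) [EMetricSpace X] :
    StarSubalgebra ℂ (EllTwo X →L[ℂ] EllTwo X) :=
  (StarAlgebra.adjoin ℂ
    {t : EllTwo X →L[ℂ] EllTwo X | HasFinitePropagation t}).topologicalClosure

/-! ### Finiteness properties of (unital) C*-algebras -/

/-- There is no proper isometry. If `v* v = 1` then `v v*` is a projection, so that `v v* < 1`
means the same as `v v* ≠ 1`. -/
def IsFiniteAlg (A : Type u) [Ring A] [StarRing A] : Prop :=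
  ¬ ∃ v : A, star v * v = 1 ∧ v * star v ≠ 1

/-- All the matrix algebras `M_n(A)`, with the conjugate transpose as `*`, are finite. -/
def IsStablyFinite (A : Type u) [Ring A] [StarRing A] : Prop :=
  ∀ n : ℕ, IsFiniteAlg (Matrix (Fin n) (Fin n) A)

/-- A quasi-diagonal set of operators on a Hilbert space. -/
def IsQuasidiagonalSet {H : Type u} [NormedAddCommGroup H] [InnerProductSpace ℂ H]
    [CompleteSpace H] (Ω : Set (H →L[ℂ] H)) : Prop :=
  ∀ F : Set (H →L[ℂ] H), F ⊆ Ω → F.Finite → ∀ ε : ℝ, 0 < ε → ∀ V : Set H, V.Finite →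
    ∃ p : H →L[ℂ] H, IsStarProjection p ∧
      FiniteDimensional ℂ (LinearMap.range (p : H →ₗ[ℂ] H)) ∧
      (∀ ω ∈ F, ‖p * ω - ω * p‖ ≤ ε) ∧ ∀ v ∈ V, ‖p v - v‖ ≤ ε

/-- `A` has a faithful representation on a Hilbert space whose image is a quasi-diagonal set of
operators. -/
def IsQuasidiagonal (A : Type u) [Ring A] [StarRing A] [Algebra ℂ A] : Prop :=
  ∃ (H : Type u) (_ : NormedAddCommGroup H) (_ : InnerProductSpace ℂ H) (_ : CompleteSpace H)
    (π : A →⋆ₐ[ℂ] (H →L[ℂ] H)), Function.Injective π ∧ IsQuasidiagonalSet (Set.range π)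

end InvSemigroupRoe

open InvSemigroupRoe

/-! Everything is compared with `HasFiniteRipsComponents`: for each `r`, chains of steps of length
at most `r` from a given point reach only finitely many points. Balls are finite by properness, and
then this is sparseness. Properness turns steps of bounded length into left multiplications by a
finite set, and right subinvariance makes left multiplication by a generator a step of bounded
length inside an `𝓛`-class; this gives local `𝓛`-finiteness. If `Y` is a finite union of components,
the projection onto `ℓ²(Y)` commutes with operators of small propagation, whence quasi-diagonality.
That implies stable finiteness, because an injective operator on a finite-dimensional space is
surjective (`eq_zero_of_almost_commuting`). Conversely, an infinite component contains a ray
(`exists_ray`), and the shift along it is a proper isometry of finite propagation. In a group, right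
translations make the components uniformly bounded. In `IntExpansion` the `𝓛`-classes are finite but
include arbitrarily long intervals. -/

namespace InvSemigroupRoe

/-! ### Rips graphs and sparseness -/

section Metric

variable {X : Type u} [EMetricSpace X]

/-- The graph in which two distinct points at distance at most `r` are adjacent. -/
def ripsGraph (X : Type u) [EMetricSpace X] (r : ℝ≥0) : SimpleGraph X where
  Adj x y := x ≠ y ∧ edist x y ≤ r
  symm := ⟨fun x y (h : x ≠ y ∧ edist x y ≤ r) => ⟨h.1.symm, edist_comm x y ▸ h.2⟩⟩
  loopless := ⟨fun x (h : x ≠ x ∧ edist x x ≤ r) => h.1 rfl⟩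

/-- All connected components of all the Rips graphs are finite. -/
def HasFiniteRipsComponents (X : Type u) [EMetricSpace X] : Prop :=
  ∀ (r : ℝ≥0) (p : X), {y | (ripsGraph X r).Reachable p y}.Finite

/-- All balls of finite radius are finite. -/
def HasFiniteBalls (X : Type u) [EMetricSpace X] : Prop :=
  ∀ (r : ℝ≥0) (p : X), {y | edist p y ≤ r}.Finite

theorem reachable_of_edist_le {r : ℝ≥0} {x y : X} (h : edist x y ≤ r) :
    (ripsGraph X r).Reachable x y := by
  by_cases hxy : x = y
  · exact hxy ▸ .rfl
  · exact SimpleGraph.Adj.reachable ⟨hxy, h⟩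

theorem mem_of_reachable {V : Type u} {G : SimpleGraph V} {Z : Set V}
    (hZ : ∀ x y, G.Adj x y → x ∈ Z → y ∈ Z) {p y : V} (hp : p ∈ Z) (h : G.Reachable p y) :
    y ∈ Z := by
  rw [SimpleGraph.reachable_iff_reflTransGen] at h
  induction h with
  | refl => exact hp
  | tail _ h ih => exact hZ _ _ h ih

theorem reachable_mono {r r' : ℝ≥0} (hr : r ≤ r') {x y : X}
    (h : (ripsGraph X r).Reachable x y) : (ripsGraph X r').Reachable x y :=
  h.mono fun x y (h : x ≠ y ∧ edist x y ≤ r) => ⟨h.1, h.2.trans (by exact_mod_cast hr)⟩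

theorem edist_lt_top_of_reachable {r : ℝ≥0} {x y : X}
    (h : (ripsGraph X r).Reachable x y) : edist x y < ∞ := by
  refine mem_of_reachable (Z := {y | edist x y < ∞}) ?_ (by simp) h
  intro a b hab ha
  exact (edist_triangle x a b).trans_lt
    (ENNReal.add_lt_top.2 ⟨ha, hab.2.trans_lt ENNReal.coe_lt_top⟩)

theorem setEDist_le {A B : Set X} {x y : X} (hx : x ∈ A) (hy : y ∈ B) :
    setEDist A B ≤ edist x y :=
  (iInf₂_le x hx).trans (iInf₂_le y hy)

theorem le_setEDist {A B : Set X} {R : ℝ≥0∞} (h : ∀ x ∈ A, ∀ y ∈ B, R ≤ edist x y) :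
    R ≤ setEDist A B :=
  le_iInf₂ fun x hx => le_iInf₂ fun y hy => h x hx y hy

/-- An `r`-step between different pieces forces their indices to have sum below `N`, so a chain
starting in `A n` stays in `A n` and the pieces of index below `N`. -/
theorem IsSparse.hasFiniteRipsComponents (h : IsSparse X) : HasFiniteRipsComponents X := by
  intro r p
  obtain ⟨A, hfin, -, hU, hA⟩ := h p
  obtain ⟨N, hN⟩ := hA r
  have hp : p ∈ ⋃ n, A n := by rw [hU]; simp [component]
  obtain ⟨n, hn⟩ := Set.mem_iUnion.1 hp
  refine ((hfin n).union ((Set.finite_lt_nat N).biUnion fun m _ => hfin m)).subset ?_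
  intro y hy
  have hy' : y ∈ component p := edist_lt_top_of_reachable hy
  refine mem_of_reachable ?_ (Or.inl hn) hy
  intro a b hab ha
  have hstep : ∀ m, a ∈ A m → b ∈ A m ∨ ∃ k, b ∈ A k ∧ m + k < N := by
    intro m ham
    have hac : a ∈ component p := by rw [← hU]; exact Set.mem_iUnion_of_mem m ham
    have hb : b ∈ ⋃ n, A n := by
      rw [hU]
      exact (edist_triangle p a b).trans_lt
        (ENNReal.add_lt_top.2 ⟨hac, hab.2.trans_lt ENNReal.coe_lt_top⟩)
    obtain ⟨k, hk⟩ := Set.mem_iUnion.1 hb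
    by_cases hmk : m = k
    · exact Or.inl (hmk ▸ hk)
    · refine Or.inr ⟨k, hk, ?_⟩
      by_contra! hlt
      exact absurd ((hN m k hmk hlt).trans_le (setEDist_le ham hk)) hab.2.not_gt
  rcases ha with ha | ha
  · rcases hstep n ha with h | ⟨k, hk, hlt⟩
    · exact Or.inl h
    · exact Or.inr (Set.mem_biUnion (show k < N by omega) hk)
  · simp only [Set.mem_iUnion] at ha
    obtain ⟨m, hm, ha⟩ := ha
    rcases hstep m ha with h | ⟨k, hk, hlt⟩
    · exact Or.inr (Set.mem_biUnion hm h)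
    · exact Or.inr (Set.mem_biUnion (show k < N by omega) hk)

/-- The `k`-components meeting the `k`-ball about `p` form a finite set `Y k`, more than `k` away
from its complement. The successive differences of the `Y k` are the required pieces. -/
theorem HasFiniteRipsComponents.isSparse (hb : HasFiniteBalls X)
    (h : HasFiniteRipsComponents X) : IsSparse X := by
  intro p
  let Y : ℕ → Set X := fun k =>
    ⋃ x ∈ {x | edist p x ≤ (k : ℝ≥0)}, {y | (ripsGraph X (k : ℝ≥0)).Reachable x y}
  have hYfin : ∀ k, (Y k).Finite := fun k => (hb k p).biUnion fun x _ => h k x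
  have hYmono : Monotone Y := by
    intro k l hkl y hy
    simp only [Y, Set.mem_iUnion, Set.mem_ofPred_eq] at hy ⊢
    obtain ⟨x, hx, hxy⟩ := hy
    have hkl' : (k : ℝ≥0) ≤ l := by exact_mod_cast hkl
    exact ⟨x, hx.trans (by exact_mod_cast hkl'), reachable_mono hkl' hxy⟩
  have hYfar : ∀ k, ∀ x ∈ Y k, ∀ y ∉ Y k, ((k : ℝ≥0) : ℝ≥0∞) < edist x y := by
    intro k x hx y hy
    by_contra! hle
    simp only [Y, Set.mem_iUnion] at hx hy
    obtain ⟨z, hz, hzx⟩ := hx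
    exact hy ⟨z, hz, hzx.trans (reachable_of_edist_le hle)⟩
  have hU : ⋃ k, Y k = component p := by
    ext y
    simp only [Y, Set.mem_iUnion, Set.mem_ofPred_eq]
    constructor
    · rintro ⟨k, x, hx, hxy⟩
      exact (edist_triangle p x y).trans_lt (ENNReal.add_lt_top.2
        ⟨hx.trans_lt ENNReal.coe_lt_top, edist_lt_top_of_reachable hxy⟩)
    · intro hy
      obtain ⟨k, hk⟩ := ENNReal.exists_nat_gt (ne_of_lt hy)
      exact ⟨k, y, by simpa using hk.le, .rfl⟩
  have hlt : ∀ n m, n < m → (((m - 1 : ℕ) : ℝ≥0) : ℝ≥0∞) ≤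
      setEDist (disjointed Y n) (disjointed Y m) := by
    intro n m hnm
    refine le_setEDist fun x hx y hy => (hYfar (m - 1) x ?_ y ?_).le
    · exact hYmono (by omega) (disjointed_subset Y n hx)
    · obtain ⟨m, rfl⟩ : ∃ m', m = m' + 1 := ⟨m - 1, by omega⟩
      rw [hYmono.disjointed_add_one] at hy
      exact hy.2
  have hcomm : ∀ A B : Set X, setEDist A B ≤ setEDist B A := fun A B =>
    le_setEDist fun x hx y hy => edist_comm (α := X) x y ▸ setEDist_le hy hx
  refine ⟨disjointed Y, fun n => (hYfin n).subset (disjointed_subset Y n),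
    fun n m hnm => disjoint_disjointed Y hnm, (iUnion_disjointed).trans hU, fun R => ?_⟩
  obtain ⟨k, hk⟩ := exists_nat_gt R
  -- The larger of the two indices exceeds `k`, and the gap is at least that index minus one, hence
  -- at least `k > R`.
  refine ⟨2 * k + 4, fun n m hnm hN => ?_⟩
  have hR : ∀ m, k + 1 ≤ m → (R : ℝ≥0∞) < (((m - 1 : ℕ) : ℝ≥0) : ℝ≥0∞) := by
    intro m hm
    have : (k : ℝ≥0) ≤ ((m - 1 : ℕ) : ℝ≥0) := by exact_mod_cast (by omega : k ≤ m - 1)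
    exact_mod_cast hk.trans_le this
  rcases lt_or_gt_of_ne hnm with h1 | h1
  · exact (hR m (by omega)).trans_le (hlt n m h1)
  · exact (hR n (by omega)).trans_le ((hlt m n h1).trans (hcomm _ _))

theorem HasAsdimZero.hasFiniteRipsComponents (hb : HasFiniteBalls X) (h : HasAsdimZero X) :
    HasFiniteRipsComponents X := by
  intro r p
  -- `r` may be `0`, while asymptotic dimension zero speaks of positive radii only.
  obtain ⟨U, hU, ⟨D, hD⟩, hsep⟩ := h (r + 1) (by positivity)
  obtain ⟨A, hA, hpA⟩ := Set.mem_sUnion.1 (hU ▸ Set.mem_univ p)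
  refine (hb D p).subset fun y hy => hD A hA p hpA y ?_
  refine mem_of_reachable ?_ hpA hy
  intro a b hab ha
  obtain ⟨B, hB, hbB⟩ := Set.mem_sUnion.1 (hU ▸ Set.mem_univ b)
  by_cases hAB : A = B
  · exact hAB ▸ hbB
  · refine absurd ((hsep A hA B hB hAB).trans_le (setEDist_le ha hbB)) (not_lt.2 ?_)
    exact hab.2.trans (by exact_mod_cast le_self_add)

/-- An infinite connected locally finite graph contains a ray. -/
theorem exists_ray {V : Type u} {G : SimpleGraph V} (hG : ∀ x, (G.neighborSet x).Finite) {p : V}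
    (hp : {y | G.Reachable p y}.Infinite) :
    ∃ f : ℕ → V, Function.Injective f ∧ ∀ n, G.Adj (f n) (f (n + 1)) := by
  -- `D x` consists of the points that some geodesic from `p` reaches through `x`. If it is
  -- infinite, then so is `D x'` for a neighbour `x'` one step further from `p`.
  let D : V → Set V := fun x => {y | G.Reachable x y ∧ G.dist p y = G.dist p x + G.dist x y}
  have step : ∀ x : {x // G.Reachable p x ∧ (D x).Infinite},
      ∃ x' : {x // G.Reachable p x ∧ (D x).Infinite},
        G.Adj x x' ∧ G.dist p x' = G.dist p x + 1 := by
    rintro ⟨x, hpx, hx⟩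
    have hsub : D x ⊆ {x} ∪ ⋃ x' ∈ {x' ∈ G.neighborSet x | G.dist p x' = G.dist p x + 1}, D x' := by
      rintro y ⟨hxy, hy⟩
      obtain ⟨w, hw⟩ := hxy.exists_walk_length_eq_dist
      cases w with
      | nil => exact Or.inl rfl
      | @cons _ x' _ hadj w =>
        right
        have h1 : G.dist x' y ≤ w.length := G.dist_le w
        have h2 : G.dist p y ≤ G.dist p x' + G.dist x' y :=
          (hpx.trans hadj.reachable).dist_triangle_left y
        have h3 : G.dist p x' ≤ G.dist p x + G.dist x x' := hpx.dist_triangle_left x'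
        have h4 : G.dist x x' = 1 := SimpleGraph.dist_eq_one_iff_adj.2 hadj
        rw [SimpleGraph.Walk.length_cons] at hw
        have h5 : G.dist p x' = G.dist p x + 1 := by omega
        exact Set.mem_biUnion (x := x') ⟨hadj, h5⟩ ⟨w.reachable, by omega⟩
    by_contra! hcon
    refine hx (((Set.finite_singleton x).union
      (((hG x).subset (Set.sep_subset _ _)).biUnion fun x' hx' => ?_)).subset hsub)
    by_contra hinf
    exact hcon ⟨x', hpx.trans (SimpleGraph.Adj.reachable hx'.1), hinf⟩ hx'.1 hx'.2
  choose g hg using step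
  let f : ℕ → {x // G.Reachable p x ∧ (D x).Infinite} := fun n =>
    g^[n] ⟨p, .rfl, by simpa [D] using hp⟩
  have hf : ∀ n, f (n + 1) = g (f n) := fun n => Function.iterate_succ_apply' g n _
  have hdist : ∀ n, G.dist p (f n) = n := by
    intro n
    induction n with
    | zero => simp [f]
    | succ n ih => rw [hf, (hg _).2, ih]
  refine ⟨fun n => f n, fun n m hnm => ?_, fun n => ?_⟩
  · rw [← hdist n, ← hdist m]
    exact congrArg _ hnm
  · simp only [hf]
    exact (hg _).1

end Metric

/-! ### Inverse semigroups -/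

section Semigroup

variable {S : Type u} [InverseSemigroup S]

theorem inv_inv_eq (s : S) : s⁻¹⁻¹ = s :=
  (InverseSemigroup.eq_inv_of_inverse s⁻¹ s (InverseSemigroup.inv_mul_self_mul_inv s)
    (InverseSemigroup.mul_inv_mul_self s)).symm

theorem isIdempotentElem_mul_inv (s : S) : IsIdempotentElem (s * s⁻¹) := by
  rw [IsIdempotentElem, ← mul_assoc, InverseSemigroup.mul_inv_mul_self]

theorem isIdempotentElem_inv_mul (s : S) : IsIdempotentElem (s⁻¹ * s) := by
  rw [IsIdempotentElem, ← mul_assoc, InverseSemigroup.inv_mul_self_mul_inv]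

theorem _root_.IsIdempotentElem.inverseSemigroup_inv {e : S} (he : IsIdempotentElem e) :
    e⁻¹ = e :=
  (InverseSemigroup.eq_inv_of_inverse e e (by rw [he, he]) (by rw [he, he])).symm

/-- With `z` the inverse of `e * f`, the element `f * z * e` is another inverse, so it equals `z`.
This makes `z` idempotent, hence its own inverse, hence equal to `e * f`. -/
theorem _root_.IsIdempotentElem.inverseSemigroup_mul {e f : S} (he : IsIdempotentElem e)
    (hf : IsIdempotentElem f) : IsIdempotentElem (e * f) := by
  have h1 := InverseSemigroup.mul_inv_mul_self (e * f)
  have h2 := InverseSemigroup.inv_mul_self_mul_inv (e * f)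
  set z := (e * f)⁻¹ with hz
  have he' : ∀ x, e * (e * x) = e * x := fun x => by rw [← mul_assoc, he]
  have hf' : ∀ x, f * (f * x) = f * x := fun x => by rw [← mul_assoc, hf]
  have hz' : f * z * e = z := by
    refine InverseSemigroup.eq_inv_of_inverse (e * f) _ ?_ ?_
    · simp only [mul_assoc, he', hf'] at h1 ⊢
      exact h1
    · have := congrArg (fun w => f * w * e) h2
      simp only [mul_assoc, he', hf'] at this ⊢
      exact this
  have hzi : IsIdempotentElem z := by
    rw [IsIdempotentElem]
    calc z * z = (f * z * e) * (f * z * e) := by rw [hz']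
      _ = f * (z * (e * f) * z) * e := by simp only [mul_assoc]
      _ = z := by rw [h2, hz']
  have : e * f = z := by
    rw [← inv_inv_eq (e * f), ← hz, hzi.inverseSemigroup_inv]
  rw [this]
  exact hzi

theorem _root_.IsIdempotentElem.inverseSemigroup_comm {e f : S} (he : IsIdempotentElem e)
    (hf : IsIdempotentElem f) : e * f = f * e := by
  have hef := he.inverseSemigroup_mul hf
  have hfe := hf.inverseSemigroup_mul he
  have he' : ∀ x, e * (e * x) = e * x := fun x => by rw [← mul_assoc, he]
  have hf' : ∀ x, f * (f * x) = f * x := fun x => by rw [← mul_assoc, hf]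
  rw [← hef.inverseSemigroup_inv]
  refine (InverseSemigroup.eq_inv_of_inverse (e * f) (f * e) ?_ ?_).symm
  · have := hef
    simp only [IsIdempotentElem, mul_assoc, he', hf'] at this ⊢
    exact this
  · have := hfe
    simp only [IsIdempotentElem, mul_assoc, he', hf'] at this ⊢
    exact this

/-- An idempotent `e` fixes `x` as soon as `e * x` generates the same left ideal as `x`. -/
theorem _root_.IsIdempotentElem.mul_eq_of_mul_mul_eq {e c x : S} (he : IsIdempotentElem e)
    (h : c * (e * x) = x) : e * x = x := by
  have hx := InverseSemigroup.mul_inv_mul_self x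
  have hcomm := he.inverseSemigroup_comm (isIdempotentElem_mul_inv x)
  -- Left multiplication by `e` on `x` becomes right multiplication by `x⁻¹ * e * x`, which commutes
  -- with left multiplication by `c`.
  have hex : e * x = x * (x⁻¹ * (e * x)) := by
    calc e * x = e * (x * x⁻¹ * x) := by rw [hx]
      _ = (e * (x * x⁻¹)) * x := by simp only [mul_assoc]
      _ = _ := by rw [hcomm]; simp only [mul_assoc]
  have hh : e * x * (x⁻¹ * (e * x)) = e * x := by
    calc e * x * (x⁻¹ * (e * x)) = e * (x * (x⁻¹ * (e * x))) := by simp only [mul_assoc]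
      _ = e * x := by rw [← hex, ← mul_assoc, he]
  calc e * x = x * (x⁻¹ * (e * x)) := hex
    _ = c * (e * x) * (x⁻¹ * (e * x)) := by rw [h]
    _ = c * (e * x * (x⁻¹ * (e * x))) := by simp only [mul_assoc]
    _ = x := by rw [hh, h]

theorem LRel.symm {s t : S} (h : LRel s t) : LRel t s := ⟨h.2, h.1⟩

/-- For partial bijections: `w` keeps `x` in its `𝓛`-class only if the range of `x` lies in the
domain of `w`. -/
theorem LRel.inv_mul_mul {w x : S} (h : LRel x (w * x)) : w⁻¹ * w * x = x := by
  obtain ⟨-, b, hb⟩ := h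
  refine (isIdempotentElem_inv_mul w).mul_eq_of_mul_mul_eq (c := b * w) ?_
  calc b * w * (w⁻¹ * w * x) = b * (w * w⁻¹ * w * x) := by simp only [mul_assoc]
    _ = x := by rw [InverseSemigroup.mul_inv_mul_self, hb]

theorem InverseSubsemigroup.subset_closure (F : Set S) :
    F ⊆ (InverseSubsemigroup.closure F : Set S) :=
  fun _ hx _ hT => hT hx

variable [EMetricSpace S]

theorem IsProperRightSubinvariant.hasFiniteBalls (h : IsProperRightSubinvariant S) :
    HasFiniteBalls S := by
  intro r p
  obtain ⟨F, hF, hF'⟩ := h.proper r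
  refine ((hF.image (· * p)).insert p).subset fun y hy => ?_
  by_cases hpy : p = y
  · exact Or.inl hpy.symm
  · obtain ⟨f, hf, rfl⟩ := hF' p y hpy hy
    exact Or.inr ⟨f, hf, rfl⟩

theorem IsLocallyLFinite.hasFiniteRipsComponents (h : IsProperRightSubinvariant S)
    (hL : IsLocallyLFinite S) : HasFiniteRipsComponents S := by
  intro r p
  obtain ⟨F, hF, hF'⟩ := h.proper r
  -- `p` need not lie in `T`; multiplying by `p⁻¹` on the right moves its component to the `𝓛`-class
  -- in `T` of the idempotent `p * p⁻¹`.
  let T := InverseSubsemigroup.closure (insert (p * p⁻¹) F)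
  have heT : p * p⁻¹ ∈ T := InverseSubsemigroup.subset_closure _ (Set.mem_insert _ _)
  have hFT : ∀ f ∈ F, f ∈ T := fun f hf =>
    InverseSubsemigroup.subset_closure _ (Set.mem_insert_of_mem _ hf)
  have hfin := hL T ⟨_, hF.insert _, rfl⟩ ⟨p * p⁻¹, heT⟩
  refine (hfin.image fun t : T => (t : S) * p).subset fun y hy => ?_
  suffices hZ : y ∈ {y : S | ∃ t : T, (t : S) = y * p⁻¹ ∧ LRel ⟨p * p⁻¹, heT⟩ t ∧
      y * p⁻¹ * p = y} by
    obtain ⟨t, ht, htL, hty⟩ := hZ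
    exact ⟨t, htL, by rw [← hty, ← ht]⟩
  refine mem_of_reachable ?_ ?_ hy
  · rintro x y hxy ⟨t, ht, ⟨⟨a, ha⟩, b, hb⟩, hx⟩
    obtain ⟨f, hf, hfy⟩ := hF' x y hxy.1 hxy.2
    obtain ⟨g, hg, hgx⟩ := hF' y x hxy.1.symm (edist_comm (α := S) x y ▸ hxy.2)
    let f' : T := ⟨f, hFT f hf⟩
    -- The reversed edge supplies the left multiplier back, so the step stays in the `𝓛`-class of
    -- `T` itself.
    let g' : T := ⟨g, hFT g hg⟩
    have hgt : g' * (f' * t) = t := Subtype.ext <| by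
      change g * (f * t) = t
      rw [ht, ← mul_assoc f, ← hfy, ← mul_assoc, ← hgx]
    refine ⟨f' * t, ?_, ⟨⟨f' * a, by rw [mul_assoc, ha]⟩, b * g', by rw [mul_assoc, hgt, hb]⟩, ?_⟩
    · change f * t = _
      rw [ht, ← mul_assoc, ← hfy]
    · rw [hfy, mul_assoc f, mul_assoc f, hx]
  · exact ⟨⟨p * p⁻¹, heT⟩, rfl,
      ⟨⟨⟨p * p⁻¹, heT⟩, Subtype.ext (isIdempotentElem_mul_inv p)⟩, ⟨p * p⁻¹, heT⟩,
      Subtype.ext (isIdempotentElem_mul_inv p)⟩, InverseSemigroup.mul_inv_mul_self p⟩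

theorem HasFiniteRipsComponents.isLocallyLFinite (h : IsProperRightSubinvariant S)
    (hC : HasFiniteRipsComponents S) : IsLocallyLFinite S := by
  rintro T ⟨F, hF, rfl⟩ s
  have hLf : ∀ f : S, LRel f (f⁻¹ * f) := fun f =>
    ⟨⟨f⁻¹, rfl⟩, f, by rw [← mul_assoc, InverseSemigroup.mul_inv_mul_self]⟩
  obtain ⟨r, hr⟩ : ∃ r : ℝ≥0, ∀ f ∈ F, edist f (f⁻¹ * f) ≤ r := by
    have hbdd : BddAbove ((fun f : S => (edist f (f⁻¹ * f)).toNNReal) '' F) := (hF.image _).bddAbove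
    obtain ⟨r, hr⟩ := hbdd
    refine ⟨r, fun f hf => ?_⟩
    rw [← ENNReal.coe_toNNReal ((h.component_eq _ _).2 (hLf f)).ne]
    exact_mod_cast hr ⟨f, hf, rfl⟩
  -- The elements that move points only within Rips components, whenever they preserve the
  -- `𝓛`-class, form an inverse subsemigroup; it suffices that it contains the generators.
  let W : InverseSubsemigroup S :=
    { carrier := {w | ∀ x, LRel x (w * x) → (ripsGraph S r).Reachable x (w * x)}
      mul_mem' := by
        intro a b ha hb x hx
        obtain ⟨-, c, hc⟩ := hx
        have h1 : LRel x (b * x) := ⟨⟨b, rfl⟩, c * a, by simpa only [mul_assoc] using hc⟩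
        have h2 : LRel (b * x) (a * (b * x)) :=
          ⟨⟨a, rfl⟩, b * c, by rw [← mul_assoc a, mul_assoc b, hc]⟩
        rw [mul_assoc]
        exact (hb x h1).trans (ha _ h2)
      inv_mem' := by
        intro a ha x hx
        have h1 : a * (a⁻¹ * x) = x := by
          have := hx.inv_mul_mul
          rwa [inv_inv_eq, mul_assoc] at this
        have h2 := ha (a⁻¹ * x) (by rw [h1]; exact hx.symm)
        rw [h1] at h2
        exact h2.symm }
  have hFW : F ⊆ (W : Set S) := by
    intro f hf x hx
    refine (reachable_of_edist_le ?_).symm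
    calc edist (f * x) x = edist (f * x) (f⁻¹ * f * x) := by rw [hx.inv_mul_mul]
      _ ≤ edist f (f⁻¹ * f) := h.rightSubinvariant _ _ _
      _ ≤ r := hr f hf
  refine Set.Finite.of_finite_image (f := Subtype.val) ((hC r s).subset ?_)
    Subtype.val_injective.injOn
  rintro _ ⟨t, ⟨⟨a, ha⟩, b, hb⟩, rfl⟩
  have ha' : (a : S) * s = t := congrArg Subtype.val ha
  have hb' : (b : S) * t = s := congrArg Subtype.val hb
  have := a.2 W hFW (s : S) (ha'.symm ▸ ⟨⟨a, ha'⟩, b, hb'⟩)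
  rw [ha'] at this
  exact this

end Semigroup

/-- Right translation carries every component into that of `1`, so one bound serves all diameters.
Components for `r + 1` are used because the gaps must exceed `r` strictly. -/
theorem HasFiniteRipsComponents.hasAsdimZero {G : Type u} [Group G] [EMetricSpace G]
    (h : IsProperRightSubinvariant G) (hC : HasFiniteRipsComponents G) : HasAsdimZero G := by
  intro r _
  have hL : ∀ x y : G, edist x y < ∞ := fun x y =>
    (h.component_eq x y).2 ⟨⟨y * x⁻¹, by group⟩, x * y⁻¹, by group⟩
  have hright : ∀ a x y : G, (ripsGraph G (r + 1)).Reachable x y →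
      (ripsGraph G (r + 1)).Reachable (x * a) (y * a) := by
    intro a x y hxy
    refine mem_of_reachable (Z := {y | (ripsGraph G (r + 1)).Reachable (x * a) (y * a)})
      (fun y z hyz hy => hy.trans (reachable_of_edist_le ?_)) .rfl hxy
    exact (h.rightSubinvariant y z a).trans hyz.2
  obtain ⟨D, hD⟩ : BddAbove ((fun y : G => (edist 1 y).toNNReal) ''
      {y | (ripsGraph G (r + 1)).Reachable 1 y}) := ((hC _ 1).image _).bddAbove
  refine ⟨Set.range fun x => {y | (ripsGraph G (r + 1)).Reachable x y}, ?_, ⟨D, ?_⟩, ?_⟩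
  · exact Set.eq_univ_of_forall fun x => ⟨_, ⟨x, rfl⟩, .rfl⟩
  · rintro _ ⟨z, rfl⟩ x hx y hy
    have hxy := hright x⁻¹ x y (hx.symm.trans hy)
    rw [mul_inv_cancel] at hxy
    have h1 : edist x y ≤ edist 1 (y * x⁻¹) := by
      simpa using h.rightSubinvariant 1 (y * x⁻¹) x
    refine h1.trans ?_
    rw [← ENNReal.coe_toNNReal (hL 1 (y * x⁻¹)).ne]
    exact_mod_cast hD ⟨_, hxy, rfl⟩
  · rintro _ ⟨a, rfl⟩ _ ⟨b, rfl⟩ hab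
    have hr : (r : ℝ≥0∞) < ((r + 1 : ℝ≥0) : ℝ≥0∞) := by
      exact_mod_cast lt_add_one r
    refine hr.trans_le (le_setEDist fun x hx y hy => ?_)
    by_contra! hlt
    refine hab (Set.ext fun z => ?_)
    have hab' : (ripsGraph G (r + 1)).Reachable a b :=
      (hx.trans (reachable_of_edist_le hlt.le)).trans hy.symm
    exact ⟨fun hz => hab'.symm.trans hz, fun hz => hab'.trans hz⟩

/-! ### Operators on `ℓ²` -/

section EllTwo

variable {X : Type u}

theorem delta_apply_self (x : X) : delta x x = 1 := by
  classical
  exact lp.single_apply_self (E := fun _ : X => ℂ) 2 x 1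

theorem delta_apply_ne {x y : X} (h : y ≠ x) : delta x y = 0 := by
  classical
  exact lp.single_apply_ne (E := fun _ : X => ℂ) 2 x 1 h

theorem inner_delta_left (x : X) (u : EllTwo X) : inner ℂ (delta x) u = u x := by
  classical
  exact (lp.inner_single_left (𝕜 := ℂ) (G := fun _ : X => ℂ) x 1 u).trans (by simp)

theorem inner_delta_right (x : X) (u : EllTwo X) : inner ℂ u (delta x) = star (u x) := by
  rw [← inner_delta_left, ← inner_conj_symm]
  rfl

theorem orthonormal_delta : Orthonormal ℂ (delta : X → EllTwo X) := by
  classical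
  rw [orthonormal_iff_ite]
  intro x y
  rw [inner_delta_left]
  split_ifs with h
  · rw [h, delta_apply_self]
  · exact delta_apply_ne h

theorem hasSum_smul_delta (u : EllTwo X) : HasSum (fun x => u x • delta x) u := by
  classical
  refine (lp.hasSum_single (p := 2) (by simp) u).congr_fun ?_
  intro x
  change _ = lp.single (E := fun _ : X => ℂ) 2 x (u x)
  rw [delta, ← lp.single_smul, smul_eq_mul, mul_one]

theorem exists_norm_sum_smul_delta_sub_lt (u : EllTwo X) {ε : ℝ} (hε : 0 < ε) :
    ∃ Z : Finset X, ‖∑ x ∈ Z, u x • delta x - u‖ < ε := by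
  obtain ⟨Z, hZ⟩ := ((hasSum_smul_delta u).eventually (Metric.ball_mem_nhds u hε)).exists
  exact ⟨Z, by rwa [← dist_eq_norm]⟩

/-- The vectors of `ℓ²(X)` that are finite linear combinations of the `δ_x` with `x ∈ Y`. -/
noncomputable def coordSubspace (Y : Set X) : Submodule ℂ (EllTwo X) :=
  Submodule.span ℂ (delta '' Y)

theorem delta_mem_coordSubspace {Y : Set X} {x : X} (hx : x ∈ Y) : delta x ∈ coordSubspace Y :=
  Submodule.subset_span ⟨x, hx, rfl⟩

theorem mem_coordSubspace_of_apply_eq_zero {Y : Set X} (hY : Y.Finite) {u : EllTwo X}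
    (h : ∀ x ∉ Y, u x = 0) : u ∈ coordSubspace Y := by
  have h1 : ∑ x ∈ hY.toFinset, u x • delta x = u := by
    refine HasSum.unique (hasSum_sum_of_ne_finset_zero fun x hx => ?_) (hasSum_smul_delta u)
    rw [h x (by simpa using hx), zero_smul]
  rw [← h1]
  exact Submodule.sum_mem _ fun x hx =>
    Submodule.smul_mem _ _ (delta_mem_coordSubspace (by simpa using hx))

theorem finiteDimensional_coordSubspace {Y : Set X} (hY : Y.Finite) :
    FiniteDimensional ℂ (coordSubspace Y) :=
  FiniteDimensional.span_of_finite ℂ (hY.image _)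

end EllTwo

/-- If an operator and its adjoint leave a subspace invariant, the operator commutes with the
orthogonal projection onto it. -/
theorem starProjection_mul_comm {H : Type u} [NormedAddCommGroup H] [InnerProductSpace ℂ H]
    [CompleteSpace H] (K : Submodule ℂ H) [K.HasOrthogonalProjection] {t : H →L[ℂ] H}
    (h : ∀ u ∈ K, t u ∈ K) (h' : ∀ u ∈ K, (star t) u ∈ K) :
    K.starProjection * t = t * K.starProjection := by
  have key : ∀ s : H →L[ℂ] H, (∀ u ∈ K, s u ∈ K) →
      K.starProjection * s * K.starProjection = s * K.starProjection := by
    intro s hs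
    ext u
    exact Submodule.starProjection_eq_self_iff.2 (hs _ (K.starProjection_apply_mem u))
  have hp : star K.starProjection = K.starProjection :=
    (isStarProjection_starProjection (U := K)).isSelfAdjoint
  have h1 := key t h
  -- The adjoint of the identity for `star t` reads `p t p = p t`, to be compared with `p t p = t
  -- p`.
  have h2 := congrArg star (key _ h')
  simp only [star_mul, star_star, hp, ← mul_assoc] at h2
  rw [← h2, h1]

/-! ### Operators of finite propagation -/

section Roe

variable {X : Type u} [EMetricSpace X]

theorem HasFinitePropagation.mem_uniformRoeAlgebra {t : EllTwo X →L[ℂ] EllTwo X}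
    (h : HasFinitePropagation t) : t ∈ uniformRoeAlgebra X :=
  StarSubalgebra.le_topologicalClosure _ (StarAlgebra.subset_adjoin ℂ _ h)

theorem coordSubspace_invariant {t : EllTwo X →L[ℂ] EllTwo X} {r : ℝ≥0}
    (h : ∀ x y : X, (r : ℝ≥0∞) < edist x y → inner ℂ (t (delta x)) (delta y) = 0)
    {Y : Set X} (hY : Y.Finite) (hYr : ∀ x y, (ripsGraph X r).Adj x y → x ∈ Y → y ∈ Y) :
    ∀ u ∈ coordSubspace Y, t u ∈ coordSubspace Y := by
  intro u hu
  change u ∈ (coordSubspace Y).comap t.toLinearMap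
  refine Submodule.span_le.2 ?_ hu
  rintro _ ⟨x, hx, rfl⟩
  refine mem_coordSubspace_of_apply_eq_zero hY fun y hy => ?_
  have hxy : (r : ℝ≥0∞) < edist x y := by
    by_contra! hle
    exact hy (hYr x y ⟨fun h => hy (h ▸ hx), hle⟩ hx)
  have := h x y hxy
  rwa [inner_delta_right, star_eq_zero] at this

/-- Projections onto finitely many unions of components of a Rips graph commute with operators of
small propagation. -/
theorem exists_commute_starProjection {t : EllTwo X →L[ℂ] EllTwo X}
    (ht : t ∈ StarAlgebra.adjoin ℂ
      {t : EllTwo X →L[ℂ] EllTwo X | HasFinitePropagation t}) :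
    ∃ r : ℝ≥0, ∀ Y : Set X, Y.Finite →
      (∀ x y, (ripsGraph X r).Adj x y → x ∈ Y → y ∈ Y) →
      ∀ [(coordSubspace Y).HasOrthogonalProjection],
        Commute (coordSubspace Y).starProjection t := by
  have hmono : ∀ {r r' : ℝ≥0}, r ≤ r' → ∀ {Y : Set X},
      (∀ x y, (ripsGraph X r').Adj x y → x ∈ Y → y ∈ Y) →
      ∀ x y, (ripsGraph X r).Adj x y → x ∈ Y → y ∈ Y := fun hr _ hY x y hxy =>
    hY x y ⟨hxy.1, hxy.2.trans (by exact_mod_cast hr)⟩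
  induction ht using StarAlgebra.adjoin_induction with
  | mem t ht =>
    obtain ⟨r, hr⟩ := ht
    refine ⟨r, fun Y hY hYr _ => starProjection_mul_comm _ (coordSubspace_invariant hr hY hYr)
      (coordSubspace_invariant (r := r) (fun x y hxy => ?_) hY hYr)⟩
    rw [ContinuousLinearMap.star_eq_adjoint, ContinuousLinearMap.adjoint_inner_left,
      ← inner_conj_symm, hr y x (by rwa [edist_comm]), map_zero]
  | algebraMap c => exact ⟨0, fun Y _ _ _ => (Algebra.commutes c _).symm⟩
  | add a b _ _ ha hb =>
    obtain ⟨r, hr⟩ := ha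
    obtain ⟨r', hr'⟩ := hb
    exact ⟨max r r', fun Y hY hYr _ => (hr Y hY (hmono (le_max_left _ _) hYr)).add_right
      (hr' Y hY (hmono (le_max_right _ _) hYr))⟩
  | mul a b _ _ ha hb =>
    obtain ⟨r, hr⟩ := ha
    obtain ⟨r', hr'⟩ := hb
    exact ⟨max r r', fun Y hY hYr _ => (hr Y hY (hmono (le_max_left _ _) hYr)).mul_right
      (hr' Y hY (hmono (le_max_right _ _) hYr))⟩
  | star a _ ha =>
    obtain ⟨r, hr⟩ := ha
    refine ⟨r, fun Y hY hYr _ => ?_⟩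
    have := (hr Y hY hYr).star_star
    rwa [(isStarProjection_starProjection (U := coordSubspace Y)).isSelfAdjoint.star_eq] at this

/-- The given representation on `ℓ²(X)` works: operators are approximated by ones commuting exactly
with the projection, vectors by finitely supported ones, and `Y` is the union of the components
meeting these supports. -/
theorem HasFiniteRipsComponents.isQuasidiagonal (hC : HasFiniteRipsComponents X) :
    IsQuasidiagonal (uniformRoeAlgebra X) := by
  refine ⟨EllTwo X, inferInstance, inferInstance, inferInstance,
    (uniformRoeAlgebra X).subtype, Subtype.val_injective, ?_⟩
  intro F hF hFfin ε hε V hV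
  have happrox : ∀ t ∈ F, ∃ (s : EllTwo X →L[ℂ] EllTwo X) (r : ℝ≥0), ‖t - s‖ ≤ ε / 2 ∧
      ∀ Y : Set X, Y.Finite → (∀ x y, (ripsGraph X r).Adj x y → x ∈ Y → y ∈ Y) →
      ∀ [(coordSubspace Y).HasOrthogonalProjection],
        Commute (coordSubspace Y).starProjection s := by
    intro t ht
    obtain ⟨⟨a, ha⟩, rfl⟩ := hF ht
    have ha' : a ∈ _root_.closure (↑(StarAlgebra.adjoin ℂ
        {t : EllTwo X →L[ℂ] EllTwo X | HasFinitePropagation t}) : Set _) := ha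
    obtain ⟨s, hs, hts⟩ := Metric.mem_closure_iff.1 ha' (ε / 2) (half_pos hε)
    obtain ⟨r, hr⟩ := exists_commute_starProjection hs
    exact ⟨s, r, by rw [← dist_eq_norm]; exact hts.le, hr⟩
  choose! s r hs hr using happrox
  obtain ⟨R, hR⟩ : ∃ R : ℝ≥0, ∀ t ∈ F, r t ≤ R := by
    obtain ⟨R, hR⟩ := (hFfin.image r).bddAbove
    exact ⟨R, fun t ht => hR ⟨t, ht, rfl⟩⟩
  have hsupp := fun v : EllTwo X => exists_norm_sum_smul_delta_sub_lt v hε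
  choose Z hZ using hsupp
  let Y : Set X := ⋃ v ∈ V, ⋃ x ∈ (Z v : Set X), {y | (ripsGraph X R).Reachable x y}
  have hYfin : Y.Finite := hV.biUnion fun v _ => (Z v).finite_toSet.biUnion fun x _ => hC R x
  have hYR : ∀ x y, (ripsGraph X R).Adj x y → x ∈ Y → y ∈ Y := by
    intro x y hxy hx
    simp only [Y, Set.mem_iUnion] at hx ⊢
    obtain ⟨v, hv, z, hz, hzx⟩ := hx
    exact ⟨v, hv, z, hz, hzx.trans hxy.reachable⟩
  have := finiteDimensional_coordSubspace hYfin
  refine ⟨(coordSubspace Y).starProjection, isStarProjection_starProjection, ?_, ?_, ?_⟩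
  · have hrange : LinearMap.range (coordSubspace Y).starProjection.toLinearMap =
        coordSubspace Y := Submodule.range_starProjection _
    rw [hrange]
    exact this
  · intro t ht
    have hcomm : Commute (coordSubspace Y).starProjection (s t) :=
      hr t ht Y hYfin fun x y hxy =>
        hYR x y ⟨hxy.1, hxy.2.trans (by exact_mod_cast hR t ht)⟩
    set p := (coordSubspace Y).starProjection with hp
    have hp1 : ‖p‖ ≤ 1 := (coordSubspace Y).starProjection_norm_le
    have heq : p * t - t * p = p * (t - s t) - (t - s t) * p := by
      rw [mul_sub, sub_mul, hcomm.eq]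
      abel
    calc ‖p * t - t * p‖ ≤ ‖p * (t - s t)‖ + ‖(t - s t) * p‖ := heq ▸ norm_sub_le _ _
      _ ≤ ‖p‖ * ‖t - s t‖ + ‖t - s t‖ * ‖p‖ := add_le_add (norm_mul_le _ _) (norm_mul_le _ _)
      _ ≤ 1 * (ε / 2) + (ε / 2) * 1 := by
        have := hs t ht
        gcongr
      _ = ε := by ring
  · intro v hv
    rw [norm_sub_rev, Submodule.starProjection_minimal]
    have hmem : ∑ x ∈ Z v, v x • delta x ∈ coordSubspace Y :=
      Submodule.sum_mem _ fun x hx => Submodule.smul_mem _ _ (delta_mem_coordSubspace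
        (Set.mem_biUnion hv (Set.mem_biUnion (x := x) hx .rfl)))
    refine (ciInf_le ⟨0, Set.forall_mem_range.2 fun _ => norm_nonneg _⟩ ⟨_, hmem⟩).trans ?_
    rw [norm_sub_rev]
    exact (hZ v).le

theorem hasFiniteRipsComponents_of_isFiniteAlg (hb : HasFiniteBalls X)
    (h : IsFiniteAlg (uniformRoeAlgebra X)) : HasFiniteRipsComponents X := by
  intro r p
  by_contra hinf
  obtain ⟨f, hf, hadj⟩ := exists_ray (G := ripsGraph X r)
    (fun x => (hb r x).subset fun y hy => hy.2) hinf
  -- The shift along the ray, fixing all other points: injective, of displacement at most `r`, and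
  -- missing `f 0`.
  let φ : X → X := Function.extend f (fun n => f (n + 1)) id
  have hφf : ∀ n, φ (f n) = f (n + 1) := fun n => hf.extend_apply _ _ n
  have hφ' : ∀ x, (¬ ∃ n, f n = x) → φ x = x := fun x hx => Function.extend_apply' _ _ x hx
  have hφ : Function.Injective φ := by
    intro x y hxy
    by_cases hx : ∃ n, f n = x <;> by_cases hy : ∃ n, f n = y
    · obtain ⟨n, rfl⟩ := hx
      obtain ⟨m, rfl⟩ := hy
      rw [hφf, hφf] at hxy
      rw [Nat.succ_injective (hf hxy)]
    · obtain ⟨n, rfl⟩ := hx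
      rw [hφf, hφ' y hy] at hxy
      exact absurd ⟨_, hxy⟩ hy
    · obtain ⟨n, rfl⟩ := hy
      rw [hφf, hφ' x hx] at hxy
      exact absurd ⟨_, hxy.symm⟩ hx
    · rwa [hφ' x hx, hφ' y hy] at hxy
  have hφ0 : ∀ x, φ x ≠ f 0 := by
    intro x hx0
    by_cases hx : ∃ n, f n = x
    · obtain ⟨n, rfl⟩ := hx
      rw [hφf] at hx0
      exact absurd (hf hx0) (by simp)
    · rw [hφ' x hx] at hx0
      exact hx ⟨0, hx0.symm⟩
  have hφd : ∀ x, edist x (φ x) ≤ r := by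
    intro x
    by_cases hx : ∃ n, f n = x
    · obtain ⟨n, rfl⟩ := hx
      rw [hφf]
      exact (hadj n).2
    · rw [hφ' x hx, edist_self]
      exact zero_le
  let V : EllTwo X →ₗᵢ[ℂ] EllTwo X :=
    (orthonormal_delta.comp φ hφ).orthogonalFamily.linearIsometry
  have hV : ∀ x, V (delta x) = delta (φ x) := by
    classical
    intro x
    refine (((orthonormal_delta.comp φ hφ).orthogonalFamily).linearIsometry_apply_single
      (i := x) (1 : ℂ)).trans ?_
    simp
  let v : EllTwo X →L[ℂ] EllTwo X := V.toContinuousLinearMap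
  have hv : HasFinitePropagation v := by
    refine ⟨r, fun x y hxy => ?_⟩
    change inner ℂ (V (delta x)) (delta y) = 0
    rw [hV, inner_delta_left]
    refine delta_apply_ne fun h => hxy.not_ge ?_
    rw [← h]
    exact hφd x
  have hvv : star v * v = 1 :=
    (v.norm_map_iff_adjoint_comp_self).1 V.norm_map
  refine h ⟨⟨v, hv.mem_uniformRoeAlgebra⟩, Subtype.ext hvv, fun h1 => ?_⟩
  have h2 : v * star v = 1 := congrArg Subtype.val h1
  have h3 : star v (delta (f 0)) = 0 := by
    ext x
    rw [← inner_delta_left, ContinuousLinearMap.star_eq_adjoint,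
      ContinuousLinearMap.adjoint_inner_right]
    change inner ℂ (V (delta x)) (delta (f 0)) = _
    rw [hV, inner_delta_left]
    exact delta_apply_ne (hφ0 x)
  have h4 : delta (f 0) = (0 : EllTwo X) := by
    have := congrArg (fun w : EllTwo X →L[ℂ] EllTwo X => w (delta (f 0))) h2
    simpa [h3] using this.symm
  exact orthonormal_delta.ne_zero (f 0) h4

end Roe

/-! ### Quasi-diagonality and stable finiteness -/

/-- A vector orthogonal to the range of an isometry vanishes if it is almost fixed by finite rank
idempotents that almost commute with the isometry. -/
theorem eq_zero_of_almost_commuting {E : Type u} [NormedAddCommGroup E] [InnerProductSpace ℂ E]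
    {M : E →ₗ[ℂ] E} (hM : ∀ x, ‖M x‖ = ‖x‖) {w : E} (hw : ∀ x, inner ℂ w (M x) = 0)
    (h : ∀ δ : ℝ, 0 < δ → ∃ (q : E →ₗ[ℂ] E) (W : Submodule ℂ E), FiniteDimensional ℂ W ∧
      (∀ x, q x ∈ W) ∧ (∀ x ∈ W, q x = x) ∧ (∀ x, ‖q (M x) - M (q x)‖ ≤ δ * ‖x‖) ∧
      ‖q w - w‖ ≤ δ) : w = 0 := by
  by_contra hw0
  have hwpos : 0 < ‖w‖ := norm_pos_iff.2 hw0
  -- The tolerance is chosen so that the final bound `‖w‖ ≤ δ + 2 * δ * (‖w‖ + δ)` is impossible.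
  obtain ⟨q, W, hfd, hqW, hq, hcomm, hqw⟩ := h (‖w‖ / (4 * (1 + ‖w‖))) (by positivity)
  set δ := ‖w‖ / (4 * (1 + ‖w‖)) with hδ
  have hδw : δ * (4 * (1 + ‖w‖)) = ‖w‖ := div_mul_cancel₀ _ (by positivity)
  have hδpos : 0 < δ := by positivity
  have hδ1 : δ ≤ 1 / 4 := by nlinarith
  have hbelow : ∀ x ∈ W, (1 - δ) * ‖x‖ ≤ ‖q (M x)‖ := by
    intro x hx
    have h1 := hcomm x
    rw [hq x hx] at h1
    have h2 := norm_sub_norm_le (M x) (q (M x))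
    rw [norm_sub_rev, hM] at h2
    linarith
  -- The compression of `M` to `W` is bounded below, hence injective, hence onto: `q w = q (M x)`
  -- for some `x ∈ W`, although `w` is orthogonal to `M x`.
  let a : W →ₗ[ℂ] W := ((q ∘ₗ M).codRestrict W fun x => hqW _) ∘ₗ W.subtype
  have ha : Function.Injective a := by
    rw [injective_iff_map_eq_zero]
    rintro ⟨x, hx⟩ hax
    have h0 : q (M x) = 0 := congrArg Subtype.val hax
    have h1 := hbelow x hx
    rw [h0, norm_zero] at h1
    have h2 : ‖x‖ ≤ 0 := by nlinarith [norm_nonneg x]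
    exact Subtype.ext (norm_le_zero_iff.1 h2)
  obtain ⟨⟨x, hx⟩, hax⟩ := LinearMap.surjective_of_injective ha ⟨q w, hqW w⟩
  have hx' : q (M x) = q w := congrArg Subtype.val hax
  have hqwn : ‖q w‖ ≤ ‖w‖ + δ := by
    have := norm_sub_norm_le (q w) w
    linarith
  have hxn : ‖x‖ ≤ 2 * (‖w‖ + δ) := by
    have h1 := hbelow x hx
    rw [hx'] at h1
    nlinarith [norm_nonneg x]
  have hsplit : inner ℂ w w = inner ℂ w (w - q w) + inner ℂ w (q (M x) - M (q x)) := by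
    rw [inner_sub_right w (q (M x)), hq x hx, hw, hx', inner_sub_right]
    ring
  have hsq : ‖w‖ * ‖w‖ ≤ ‖w‖ * δ + ‖w‖ * (δ * ‖x‖) := by
    calc ‖w‖ * ‖w‖ = ‖inner ℂ w w‖ := by
          rw [inner_self_eq_norm_sq_to_K]
          simp [sq]
      _ ≤ ‖inner ℂ w (w - q w)‖ + ‖inner ℂ w (q (M x) - M (q x))‖ := hsplit ▸ norm_add_le _ _
      _ ≤ ‖w‖ * ‖w - q w‖ + ‖w‖ * ‖q (M x) - M (q x)‖ :=
        add_le_add (norm_inner_le_norm _ _) (norm_inner_le_norm _ _)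
      _ ≤ _ := by
        rw [norm_sub_rev w]
        have := hcomm x
        gcongr
  have h5 : ‖w‖ ≤ δ + δ * ‖x‖ := by
    refine le_of_mul_le_mul_left ?_ hwpos
    linarith
  have h6 : δ * ‖x‖ ≤ δ * (2 * (‖w‖ + δ)) := by gcongr
  nlinarith

theorem norm_le_sum_norm_apply {H : Type u} [NormedAddCommGroup H] {n : ℕ}
    (x : PiLp 2 (fun _ : Fin n => H)) : ‖x‖ ≤ ∑ i, ‖x i‖ := by
  rw [PiLp.norm_eq_of_L2]
  refine Real.sqrt_le_iff.2 ⟨by positivity, ?_⟩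
  exact Finset.sum_sq_le_sq_sum_of_nonneg fun i _ => norm_nonneg _

/-! ### Matrices of operators acting on column vectors -/

section Matrix

variable {H : Type u} [NormedAddCommGroup H] [InnerProductSpace ℂ H] {n : ℕ}

/-- The action of a matrix of operators on the column vectors with entries in `H`. -/
noncomputable def matrixAct (M : Matrix (Fin n) (Fin n) (H →L[ℂ] H)) :
    PiLp 2 (fun _ : Fin n => H) →ₗ[ℂ] PiLp 2 (fun _ : Fin n => H) where
  toFun x := WithLp.toLp 2 fun i => ∑ j, M i j (x j)
  map_add' x y := by
    ext i
    simp [Finset.sum_add_distrib]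
  map_smul' c x := by
    ext i
    simp [Finset.smul_sum]

theorem matrixAct_apply (M : Matrix (Fin n) (Fin n) (H →L[ℂ] H))
    (x : PiLp 2 (fun _ : Fin n => H)) (i : Fin n) : matrixAct M x i = ∑ j, M i j (x j) := rfl

theorem matrixAct_mul (M N : Matrix (Fin n) (Fin n) (H →L[ℂ] H))
    (x : PiLp 2 (fun _ : Fin n => H)) : matrixAct (M * N) x = matrixAct M (matrixAct N x) := by
  ext i
  simp only [matrixAct_apply, Matrix.mul_apply, map_sum, sum_apply]
  rw [Finset.sum_comm]
  rfl

theorem matrixAct_diagonal (p : H →L[ℂ] H) (x : PiLp 2 (fun _ : Fin n => H)) (i : Fin n) :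
    matrixAct (Matrix.diagonal fun _ => p) x i = p (x i) := by
  rw [matrixAct_apply, Finset.sum_eq_single i]
  · simp
  · intro j _ hj
    simp [Matrix.diagonal_apply_ne _ hj.symm]
  · simp

theorem matrixAct_one (x : PiLp 2 (fun _ : Fin n => H)) : matrixAct 1 x = x := by
  ext i
  exact matrixAct_diagonal 1 x i

theorem matrixAct_injective :
    Function.Injective (matrixAct : Matrix (Fin n) (Fin n) (H →L[ℂ] H) → _) := by
  intro M N h
  ext i j v
  have := congrArg (fun w => w i) (LinearMap.congr_fun h (PiLp.single 2 j v))
  simp only [matrixAct_apply] at this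
  rw [Finset.sum_eq_single j, Finset.sum_eq_single j] at this
  · simpa using this
  all_goals simp +contextual

theorem inner_matrixAct_left [CompleteSpace H] (M : Matrix (Fin n) (Fin n) (H →L[ℂ] H))
    (x y : PiLp 2 (fun _ : Fin n => H)) :
    inner ℂ (matrixAct M x) y = inner ℂ x (matrixAct (star M) y) := by
  simp only [PiLp.inner_apply, matrixAct_apply, sum_inner, inner_sum, Matrix.star_apply,
    ContinuousLinearMap.star_eq_adjoint, ContinuousLinearMap.adjoint_inner_right]
  exact Finset.sum_comm

end Matrix

/-- For an isometry `M` over the image of `A`, each `x - M M* x` is orthogonal to the range of `M`;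
the diagonal matrices with entry `p` almost commute with `M`, so this vector vanishes. -/
theorem IsQuasidiagonal.isStablyFinite {A : Type u} [Ring A] [StarRing A] [Algebra ℂ A]
    (h : IsQuasidiagonal A) : IsStablyFinite A := by
  obtain ⟨H, _, _, _, π, hπ, hQ⟩ := h
  rintro n ⟨v, hv, hv'⟩
  let M : Matrix (Fin n) (Fin n) (H →L[ℂ] H) := v.map π
  have hstar : (star v).map π = star M := by
    ext1 i j
    exact map_star π (v j i)
  have hM : star M * M = 1 := by
    rw [← hstar, ← Matrix.map_mul, hv]
    exact Matrix.map_one _ (map_zero π) (map_one π)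
  have hM' : M * star M ≠ 1 := by
    intro h1
    rw [← hstar, ← Matrix.map_mul, ← Matrix.map_one π (map_zero π) (map_one π)] at h1
    exact hv' (Matrix.map_injective hπ h1)
  refine hM' (matrixAct_injective (LinearMap.ext fun x => ?_))
  rw [matrixAct_one, matrixAct_mul]
  refine (sub_eq_zero.1 ?_).symm
  refine eq_zero_of_almost_commuting (M := matrixAct M) ?_ ?_ ?_
  · intro y
    have h1 : inner ℂ (matrixAct M y) (matrixAct M y) = inner ℂ y y := by
      rw [inner_matrixAct_left, ← matrixAct_mul, hM, matrixAct_one]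
    rw [@norm_eq_sqrt_re_inner ℂ, @norm_eq_sqrt_re_inner ℂ _ _ _ _ y, h1]
  · intro y
    rw [inner_sub_left, inner_matrixAct_left M (matrixAct (star M) x), ← matrixAct_mul, hM,
      matrixAct_one, inner_matrixAct_left (star M), star_star, sub_self]
  · intro δ hδ
    set w := x - matrixAct M (matrixAct (star M) x) with hw
    -- The commutator estimate sums `n * n` errors, the vector estimate `n`; adding `1` covers `n =
    -- 0`.
    let ε : ℝ := δ / ((n + 1) * (n + 1))
    have hε : 0 < ε := by positivity
    have hεδ : (n + 1) * (n + 1) * ε = δ := mul_div_cancel₀ _ (by positivity)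
    have hn : (0 : ℝ) ≤ n := Nat.cast_nonneg n
    have hn1 : n * ε ≤ δ := by
      rw [← hεδ]
      nlinarith [mul_nonneg hn hε.le, mul_nonneg hn (mul_nonneg hn hε.le)]
    have hn2 : n * (n * ε) ≤ δ := by
      rw [← hεδ]
      nlinarith [mul_nonneg hn hε.le]
    obtain ⟨p, hp, hpfd, hpc, hpw⟩ := hQ (Set.range fun ij : Fin n × Fin n => M ij.1 ij.2)
      (by rintro _ ⟨ij, rfl⟩; exact ⟨v ij.1 ij.2, rfl⟩) (Set.finite_range _) ε hε
      (Set.range fun i => w i) (Set.finite_range _)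
    have hpp : ∀ u, p (p u) = p u := fun u =>
      congrArg (fun s : H →L[ℂ] H => s u) hp.isIdempotentElem.eq
    let g : (Fin n → LinearMap.range (p : H →ₗ[ℂ] H)) →ₗ[ℂ] PiLp 2 (fun _ : Fin n => H) :=
      { toFun := fun y => WithLp.toLp 2 fun i => (y i : H)
        map_add' := fun _ _ => rfl
        map_smul' := fun _ _ => rfl }
    refine ⟨matrixAct (Matrix.diagonal fun _ => p), LinearMap.range g, inferInstance, ?_, ?_,
      ?_, ?_⟩
    · intro y
      refine ⟨fun i => ⟨p (y i), y i, rfl⟩, ?_⟩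
      ext i
      exact (matrixAct_diagonal p y i).symm
    · rintro _ ⟨y, rfl⟩
      ext i
      rw [matrixAct_diagonal]
      obtain ⟨z, hz⟩ := (y i).2
      change p (y i : H) = (y i : H)
      rw [← hz]
      exact hpp z
    · intro y
      refine (norm_le_sum_norm_apply _).trans ?_
      have hi : ∀ i, ‖(matrixAct (Matrix.diagonal fun _ => p) (matrixAct M y) -
          matrixAct M (matrixAct (Matrix.diagonal fun _ => p) y)) i‖ ≤ n * ε * ‖y‖ := by
        intro i
        have h1 : (matrixAct (Matrix.diagonal fun _ => p) (matrixAct M y) -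
            matrixAct M (matrixAct (Matrix.diagonal fun _ => p) y)) i =
            ∑ j, (p * M i j - M i j * p) (y j) := by
          rw [PiLp.sub_apply, matrixAct_diagonal, matrixAct_apply, matrixAct_apply, map_sum,
            ← Finset.sum_sub_distrib]
          refine Finset.sum_congr rfl fun j _ => ?_
          rw [matrixAct_diagonal]
          rfl
        rw [h1]
        calc ‖∑ j, (p * M i j - M i j * p) (y j)‖
            ≤ ∑ _j : Fin n, ε * ‖y‖ := by
              refine norm_sum_le_of_le _ fun j _ => ?_
              exact ContinuousLinearMap.le_of_opNorm_le_of_le _ (hpc _ ⟨(i, j), rfl⟩)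
                (PiLp.norm_apply_le y j)
          _ = n * ε * ‖y‖ := by simp; ring
      calc _ ≤ ∑ _i : Fin n, n * ε * ‖y‖ := Finset.sum_le_sum fun i _ => hi i
        _ = n * (n * ε) * ‖y‖ := by simp; ring
        _ ≤ δ * ‖y‖ := by gcongr
    · refine (norm_le_sum_norm_apply _).trans ?_
      calc _ ≤ ∑ _i : Fin n, ε := by
            refine Finset.sum_le_sum fun i _ => ?_
            rw [PiLp.sub_apply, matrixAct_diagonal]
            exact hpw _ ⟨i, rfl⟩
        _ = n * ε := by simp
        _ ≤ δ := hn1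

theorem IsStablyFinite.isFiniteAlg {A : Type u} [Ring A] [StarRing A]
    (h : IsStablyFinite A) : IsFiniteAlg A := by
  rintro ⟨v, hv, hv'⟩
  have hstar : star (Matrix.diagonal fun _ : Fin 1 => v) = Matrix.diagonal fun _ => star v :=
    Matrix.diagonal_conjTranspose _
  refine h 1 ⟨Matrix.diagonal fun _ => v, ?_, fun h1 => hv' ?_⟩
  · rw [hstar, Matrix.diagonal_mul_diagonal, hv, Matrix.diagonal_one]
  · rw [hstar, Matrix.diagonal_mul_diagonal] at h1
    simpa using congrFun (congrFun h1 0) 0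

/-! ### An inverse semigroup of finite sets of integers -/

open scoped Pointwise

/-- The prefix expansion of `ℤ`: a finite set of integers together with two of its points, the
first of which is `0`. -/
@[ext]
structure IntExpansion : Type where
  /-- The finite set. -/
  support : Finset ℤ
  /-- The second distinguished point. -/
  shift : ℤ
  zero_mem : (0 : ℤ) ∈ support
  shift_mem : shift ∈ support

namespace IntExpansion

instance : Mul IntExpansion where
  mul s t :=
    { support := s.support ∪ (s.shift +ᵥ t.support)
      shift := s.shift + t.shift
      zero_mem := Finset.mem_union_left _ s.zero_mem
      shift_mem := Finset.mem_union_right _ (Finset.vadd_mem_vadd_finset t.shift_mem) }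

instance : Inv IntExpansion where
  inv s :=
    { support := -s.shift +ᵥ s.support
      shift := -s.shift
      zero_mem := by simpa using Finset.vadd_mem_vadd_finset (a := -s.shift) s.shift_mem
      shift_mem := by simpa using Finset.vadd_mem_vadd_finset (a := -s.shift) s.zero_mem }

theorem support_mul (s t : IntExpansion) :
    (s * t).support = s.support ∪ (s.shift +ᵥ t.support) := rfl

theorem shift_mul (s t : IntExpansion) : (s * t).shift = s.shift + t.shift := rfl

theorem support_inv (s : IntExpansion) : s⁻¹.support = -s.shift +ᵥ s.support := rfl

theorem shift_inv (s : IntExpansion) : s⁻¹.shift = -s.shift := rfl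

instance : InverseSemigroup IntExpansion where
  mul_assoc s t w := by
    ext1
    · simp only [support_mul, shift_mul, Finset.vadd_finset_union, vadd_vadd, Finset.union_assoc]
    · simp only [shift_mul, add_assoc]
  mul_inv_mul_self s := by
    ext1
    · simp [support_mul, shift_mul, support_inv, shift_inv, vadd_vadd]
    · simp [shift_mul, shift_inv]
  inv_mul_self_mul_inv s := by
    ext1
    · simp [support_mul, shift_mul, support_inv, shift_inv, vadd_vadd]
    · simp [shift_mul, shift_inv]
  eq_inv_of_inverse s t h h' := by
    have hk : t.shift = -s.shift := by
      have := congrArg shift h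
      simp only [shift_mul] at this
      omega
    have h1 : s.shift +ᵥ t.support ⊆ s.support := by
      have := congrArg support h
      rw [support_mul, support_mul] at this
      conv_rhs => rw [← this]
      exact Finset.subset_union_right.trans Finset.subset_union_left
    have h2 : -s.shift +ᵥ s.support ⊆ t.support := by
      have := congrArg support h'
      rw [support_mul, support_mul, hk] at this
      conv_rhs => rw [← this]
      exact Finset.subset_union_right.trans Finset.subset_union_left
    ext1
    · refine Finset.Subset.antisymm ?_ h2
      have := Finset.vadd_finset_subset_vadd_finset (a := -s.shift) h1
      rwa [vadd_vadd, neg_add_cancel, zero_vadd] at this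
    · exact hk

/-- The set of an element, translated so that its second distinguished point is `0`. -/
def base (s : IntExpansion) : Finset ℤ := -s.shift +ᵥ s.support

theorem neg_shift_mem_base (s : IntExpansion) : -s.shift ∈ s.base := by
  simpa [base] using Finset.vadd_mem_vadd_finset (a := -s.shift) s.zero_mem

theorem base_mul (s t : IntExpansion) : (s * t).base = (-t.shift +ᵥ s.base) ∪ t.base := by
  simp only [base, support_mul, shift_mul, Finset.vadd_finset_union, vadd_vadd]
  congr 2
  · ring
  · ring

theorem eq_of_base_eq {s t : IntExpansion} (h : s.base = t.base) (h' : s.shift = t.shift) :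
    s = t := by
  ext1
  · have := congrArg (s.shift +ᵥ ·) h
    simpa [base, vadd_vadd, ← h'] using this
  · exact h'

/-- The element with set `{0, c}` and second distinguished point `c`. -/
def step (c : ℤ) : IntExpansion where
  support := {0, c}
  shift := c
  zero_mem := by simp
  shift_mem := by simp

/-- The left factor adds only the points `-s.shift` and `-t.shift` to `s.base`, and both are already
there. -/
theorem step_mul {s t : IntExpansion} (h : s.base = t.base) : step (t.shift - s.shift) * s = t := by
  refine eq_of_base_eq ?_ (by simp [shift_mul, step])
  rw [base_mul, ← h]
  refine Finset.union_eq_right.2 fun x hx => ?_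
  have ht : -t.shift ∈ s.base := h ▸ t.neg_shift_mem_base
  obtain ⟨y, hy, rfl⟩ := Finset.mem_vadd_finset.1 hx
  obtain ⟨z, hz, rfl⟩ := Finset.mem_vadd_finset.1 hy
  simp only [step, Finset.mem_insert, Finset.mem_singleton] at hz
  rcases hz with rfl | rfl
  · convert! ht using 1
    simp only [step, vadd_eq_add]
    ring
  · convert! s.neg_shift_mem_base using 1
    simp [step]

/-- Left multiplication can only enlarge the base. -/
theorem lRel_iff {s t : IntExpansion} : LRel s t ↔ s.base = t.base := by
  constructor
  · rintro ⟨⟨a, rfl⟩, b, hb⟩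
    refine Finset.Subset.antisymm ?_ ?_
    · rw [base_mul]
      exact Finset.subset_union_right
    · conv_rhs => rw [← hb, base_mul]
      exact Finset.subset_union_right
  · exact fun h => ⟨⟨_, step_mul h⟩, _, step_mul h.symm⟩

/-- Within an `𝓛`-class an element is determined by its shift, so the class carries the metric of a
finite subset of `ℤ`. -/
noncomputable instance : EMetricSpace IntExpansion where
  edist s t := if s.base = t.base then ((s.shift - t.shift).natAbs : ℝ≥0∞) else ∞
  edist_self s := by simp
  edist_comm s t := by
    simp only [eq_comm (a := s.base), ← Int.natAbs_neg (s.shift - t.shift), neg_sub]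
  edist_triangle s t w := by
    by_cases h1 : s.base = t.base
    · by_cases h2 : t.base = w.base
      · simp only [h1, h2, if_true]
        norm_cast
        omega
      · simp [h2]
    · simp [h1]
  eq_of_edist_eq_zero {s t} h := by
    split_ifs at h with h1
    · refine eq_of_base_eq h1 ?_
      have : (s.shift - t.shift).natAbs = 0 := by exact_mod_cast h
      omega
    · exact absurd h (by simp)

theorem edist_eq (s t : IntExpansion) :
    edist s t = if s.base = t.base then ((s.shift - t.shift).natAbs : ℝ≥0∞) else ∞ := rfl

theorem edist_lt_top_iff {s t : IntExpansion} : edist s t < ∞ ↔ s.base = t.base := by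
  rw [edist_eq]
  split_ifs with h <;> simp [h]

theorem isProperRightSubinvariant : IsProperRightSubinvariant IntExpansion where
  uniformlyDiscrete := by
    refine ⟨1 / 2, by positivity, fun x y hxy => ?_⟩
    rw [edist_eq]
    split_ifs with h
    · have h1 : 1 ≤ (x.shift - y.shift).natAbs := by
        by_contra! hlt
        exact hxy (eq_of_base_eq h (by omega))
      calc (((1 / 2 : ℝ≥0)) : ℝ≥0∞) < ((1 : ℝ≥0) : ℝ≥0∞) := by
            rw [ENNReal.coe_lt_coe]
            exact half_lt_self one_pos
        _ ≤ _ := by exact_mod_cast h1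
    · exact ENNReal.coe_lt_top
  component_eq x y := edist_lt_top_iff.trans lRel_iff.symm
  rightSubinvariant s t x := by
    by_cases h : s.base = t.base
    · simp [edist_eq, base_mul, shift_mul, h]
    · simp [edist_eq s t, h]
  proper r := by
    obtain ⟨N, hN⟩ := exists_nat_ge r
    refine ⟨step '' Set.Icc (-N : ℤ) N, (Set.finite_Icc _ _).image _, fun x y _ hr => ?_⟩
    have h : x.base = y.base := edist_lt_top_iff.1 (hr.trans_lt ENNReal.coe_lt_top)
    refine ⟨_, ⟨y.shift - x.shift, ?_, rfl⟩, (step_mul h).symm⟩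
    rw [edist_eq, if_pos h] at hr
    have hr' : ((x.shift - y.shift).natAbs : ℝ≥0) ≤ r := by exact_mod_cast hr
    have : (x.shift - y.shift).natAbs ≤ N := by exact_mod_cast hr'.trans hN
    exact ⟨by omega, by omega⟩

theorem isQuasiCountable : IsQuasiCountable IntExpansion := by
  have hinj : Function.Injective fun s : IntExpansion => (s.support, s.shift) := by
    intro s t h
    ext1
    · exact congrArg Prod.fst h
    · exact congrArg Prod.snd h
  have := hinj.countable
  exact ⟨Set.univ, Set.countable_univ, fun s =>
    InverseSubsemigroup.subset_closure _ (Or.inl trivial)⟩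

theorem finite_component (p : IntExpansion) : (component p).Finite := by
  refine Set.Finite.of_finite_image (f := fun s => -s.shift)
    (p.base.finite_toSet.subset ?_) ?_
  · rintro _ ⟨s, hs, rfl⟩
    rw [edist_lt_top_iff.1 hs]
    exact s.neg_shift_mem_base
  · intro s hs t ht hst
    exact eq_of_base_eq ((edist_lt_top_iff.1 hs).symm.trans (edist_lt_top_iff.1 ht))
      (neg_injective hst)

theorem isSparse : IsSparse IntExpansion :=
  HasFiniteRipsComponents.isSparse isProperRightSubinvariant.hasFiniteBalls fun _ p =>
    (finite_component p).subset fun _ hy => edist_lt_top_of_reachable hy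

theorem not_hasAsdimZero : ¬ HasAsdimZero IntExpansion := by
  intro h
  obtain ⟨U, hU, ⟨D, hD⟩, hsep⟩ := h 1 one_pos
  obtain ⟨N, hN⟩ := exists_nat_gt D
  -- All `s j` have base `[-N, 0]`, and consecutive ones are at distance `1`. A cover with gaps
  -- larger than `1` cannot split this chain, whose ends are `N > D` apart.
  let s : ∀ j : ℕ, j ≤ N → IntExpansion := fun j hj =>
    { support := (j : ℤ) +ᵥ Finset.Icc (-N : ℤ) 0
      shift := j
      zero_mem := Finset.mem_vadd_finset.2 ⟨-j, Finset.mem_Icc.2 (by omega), by simp⟩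
      shift_mem := Finset.mem_vadd_finset.2 ⟨0, Finset.mem_Icc.2 (by omega), by simp⟩ }
  have hbase : ∀ i hi j hj, (s i hi).base = (s j hj).base := by
    intro i hi j hj
    simp [s, base, vadd_vadd]
  obtain ⟨A, hA, hsA⟩ := Set.mem_sUnion.1 (hU ▸ Set.mem_univ (s 0 (Nat.zero_le N)))
  have hmem : ∀ j hj, s j hj ∈ A := by
    intro j
    induction j with
    | zero => exact fun _ => hsA
    | succ j ih =>
      intro hj
      obtain ⟨B, hB, hsB⟩ := Set.mem_sUnion.1 (hU ▸ Set.mem_univ (s (j + 1) hj))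
      by_cases hAB : A = B
      · exact hAB ▸ hsB
      · have h1 := (hsep A hA B hB hAB).trans_le (setEDist_le (ih (by omega)) hsB)
        rw [edist_eq, if_pos (hbase j (by omega) (j + 1) hj)] at h1
        simp [s] at h1
  have h2 := hD A hA _ hsA _ (hmem N le_rfl)
  rw [edist_eq, if_pos (hbase 0 (Nat.zero_le N) N le_rfl)] at h2
  have h3 : (N : ℝ≥0∞) ≤ D := by simpa [s] using h2
  exact absurd hN (not_lt.2 (by exact_mod_cast h3))

end IntExpansion

end InvSemigroupRoe

theorem theorem5p12 :
    -- the five conditions are equivalent, and asymptotic dimension `0` implies them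
    (∀ (S : Type u) [InverseSemigroup S] [EMetricSpace S],
      IsQuasiCountable S → IsProperRightSubinvariant S →
        List.TFAE
          [IsLocallyLFinite S,
            IsSparse S,
            IsQuasidiagonal (uniformRoeAlgebra S),
            IsStablyFinite (uniformRoeAlgebra S),
            IsFiniteAlg (uniformRoeAlgebra S)] ∧
        (HasAsdimZero S → IsSparse S)) ∧
    -- the converse fails
    (∃ (T : Type) (_ : InverseSemigroup T) (_ : EMetricSpace T),
      IsQuasiCountable T ∧ IsProperRightSubinvariant T ∧ IsSparse T ∧ ¬ HasAsdimZero T) ∧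
    -- the converse holds for groups
    (∀ (G : Type u) [Group G] [EMetricSpace G],
      IsQuasiCountable G → IsProperRightSubinvariant G → IsSparse G → HasAsdimZero G) := by
  refine ⟨fun S _ _ _ h => ⟨?_, fun h0 => ?_⟩,
    ⟨IntExpansion, inferInstance, inferInstance, IntExpansion.isQuasiCountable,
      IntExpansion.isProperRightSubinvariant, IntExpansion.isSparse,
      IntExpansion.not_hasAsdimZero⟩,
    fun G _ _ _ h hs => hs.hasFiniteRipsComponents.hasAsdimZero h⟩
  · tfae_have 1 → 2 := fun h1 => (h1.hasFiniteRipsComponents h).isSparse h.hasFiniteBalls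
    tfae_have 2 → 1 := fun h2 => h2.hasFiniteRipsComponents.isLocallyLFinite h
    tfae_have 2 → 3 := fun h2 => h2.hasFiniteRipsComponents.isQuasidiagonal
    tfae_have 3 → 4 := IsQuasidiagonal.isStablyFinite
    tfae_have 4 → 5 := IsStablyFinite.isFiniteAlg
    tfae_have 5 → 2 := fun h5 =>
      (hasFiniteRipsComponents_of_isFiniteAlg h.hasFiniteBalls h5).isSparse h.hasFiniteBalls
    tfae_finish
  · exact (h0.hasFiniteRipsComponents h.hasFiniteBalls).isSparse h.hasFiniteBalls
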